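/- Let $M$ be a bounded, connected, embedded complex submanifold of $\mathbb{C}^d$, with $\partial M := \overline{M}\setminus M$, Kobayashi distance $\mathsf{k}_M$ and Kobayashi--Royden pseudometric $\kappa_M$. For $\lambda \ge 1$ and $\kappa \ge 0$, a $(\lambda,\kappa)$-almost-geodesic is an absolutely continuous curve $\sigma : [a,b] \to M$ such that $\frac{1}{\lambda}|t-s| - \kappa \le \mathsf{k}_M(\sigma(t),\sigma(s)) \le \lambda|t-s| + \kappa$ for all $s,t \in [a,b]$ and $\kappa_M(\sigma(t);\sigma'(t)) \le \lambda$ for almost every $t$; a real Kobayashi geodesic is a map $\sigma:[a,b]\to M$ with $\mathsf{k}_M(\sigma(s),\sigma(t)) = |s-t|$ for all $s,t \in [a,b]$. We say that a class of curves in $M$ is visible if for all $p \ne q$ in $\partial M$ there are neighbourhoods $V$ of $p$ and $W$ of $q$ in $\mathbb{C}^d$ with $\overline{V} \cap \overline{W} = \emptyset$ and a compact set $K \subset M$ such that every curve of the class with initial point in $V$ and terminal point in $W$ meets $K$. For $\kappa>0$, $M$ is a $(1,\kappa)$-visibility submanifold if any two distinct points of $M$ can be joined by a $(1,\kappa)$-almost-geodesic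 and the $(1,\kappa)$-almost-geodesics are visible. $M$ is a BNT-visibility submanifold if $(M,\mathsf{k}_M)$ is Cauchy-complete and the real Kobayashi geodesics are visible. Write $(x|y)_o := \frac12\big(\mathsf{k}_M(x,o) + \mathsf{k}_M(y,o) - \mathsf{k}_M(x,y)\big)$. Let $S \subset \partial M$ be a closed set such that for all $p \ne q$ in $\partial M$ there exist $p' \in \partial M$ and $r > 0$ with $p \in B(p',r)$, $q \in \partial M \setminus \overline{B(p',r)}$ and $S \cap \partial B(p',r) = \emptyset$, where $B(p',r)$ is the Euclidean open ball. Suppose that for some point $o_0 \in M$ and every $\xi\in\partial M \setminus S$, $\mathsf{k}_M(z,o_0) \to \infty$ as $z \to \xi$, $z \in M$. Then, for every $o \in M$, the following are equivalent: 1. For all $p \ne q$ in $\partial M \setminus S$, $\limsup_{(x,y)\to(p,q),\ x,y\in M} (x|y)_o < \infty$. 2. For all $p \ne q$ in $\partial M$, $\limsup_{(x,y)\to(p,q),\ x,y\in M} (x|y)_o < \infty$. 3. $M$ is a $(1,\kappa)$-visibility submanifold for every $\kappa > 0$, and the $(1,0)$-almost-geodesics are visible. Moreover, if (3) holds and $(M,\mathsf{k}_M)$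 is Cauchy-complete, then $M$ is a BNT-visibility submanifold. -/

import Mathlib

open Filter Topology

noncomputable section

namespace KobayashiVisibility

variable {d : ℕ}

/-- Embedded complex submanifolds of `ℂ^d`: there is a dimension `n ≤ d` such that near each point
of `M` some holomorphic change of coordinates of the ambient space flattens `M` to
`ℂ^n × {0}`. -/
def IsEmbeddedComplexSubmanifold (M : Set (EuclideanSpace ℂ (Fin d))) : Prop :=
  ∃ n : ℕ, n ≤ d ∧ ∀ p ∈ M,
    ∃ Φ : OpenPartialHomeomorph (EuclideanSpace ℂ (Fin d)) (EuclideanSpace ℂ (Fin d)),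
      p ∈ Φ.source ∧
      DifferentiableOn ℂ Φ Φ.source ∧
      DifferentiableOn ℂ Φ.symm Φ.target ∧
      ∀ z ∈ Φ.source, z ∈ M ↔ ∀ i : Fin d, n ≤ (i : ℕ) → Φ z i = 0

/-- The boundary `∂M = closure M \ M`. -/
def bdry (M : Set (EuclideanSpace ℂ (Fin d))) : Set (EuclideanSpace ℂ (Fin d)) :=
  closure M \ M

/-- Holomorphic maps from the open unit disc of `ℂ` to `M`. For an embedded submanifold `M` these
are exactly the holomorphic maps into the ambient space with values in `M`. -/
def IsHolomorphicDisc (M : Set (EuclideanSpace ℂ (Fin d)))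
    (f : ℂ → EuclideanSpace ℂ (Fin d)) : Prop :=
  DifferentiableOn ℂ f (Metric.ball 0 1) ∧ Set.MapsTo f (Metric.ball 0 1) M

/-- The Poincaré distance of the unit disc, normalised so that its infinitesimal form is
`|v| / (1 - |ζ|²)`. -/
def poincareDist (a b : ℂ) : ℝ :=
  Real.artanh (‖a - b‖ / ‖1 - (starRingEnd ℂ) a * b‖)

/-- `DiscChain M x y ℓ`: there is a finite chain of holomorphic discs in `M` from `x` to `y` whose
total Poincaré length is `ℓ`. -/
inductive DiscChain (M : Set (EuclideanSpace ℂ (Fin d))) :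
    EuclideanSpace ℂ (Fin d) → EuclideanSpace ℂ (Fin d) → ℝ → Prop
  | nil (x : EuclideanSpace ℂ (Fin d)) (hx : x ∈ M) : DiscChain M x x 0
  | cons (f : ℂ → EuclideanSpace ℂ (Fin d)) (hf : IsHolomorphicDisc M f) (a b : ℂ)
      (ha : a ∈ Metric.ball (0 : ℂ) 1) (hb : b ∈ Metric.ball (0 : ℂ) 1)
      (z : EuclideanSpace ℂ (Fin d)) (l : ℝ) (h : DiscChain M (f b) z l) :
      DiscChain M (f a) z (poincareDist a b + l)

/-- The Kobayashi distance `k_M`: the infimum of the lengths of chains of holomorphic discs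
joining the two points. (When `M` is a connected submanifold such chains exist.) -/
def kobDist (M : Set (EuclideanSpace ℂ (Fin d))) (x y : EuclideanSpace ℂ (Fin d)) : ℝ :=
  sInf {l : ℝ | DiscChain M x y l}

/-- The Kobayashi--Royden pseudometric `κ_M(z; v)`: the infimum of the `α > 0` such that
`α f'(0) = v` for some holomorphic disc `f` in `M` with `f 0 = z`. It is finite when `v` is tangent
to `M` at `z ∈ M`. -/
def kobMetric (M : Set (EuclideanSpace ℂ (Fin d))) (z v : EuclideanSpace ℂ (Fin d)) : ENNReal :=
  sInf {c : ENNReal | ∃ α : ℝ, 0 < α ∧ c = ENNReal.ofReal α ∧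
    ∃ f : ℂ → EuclideanSpace ℂ (Fin d), IsHolomorphicDisc M f ∧ f 0 = z ∧
      (α : ℂ) • deriv f 0 = v}

/-- `σ : [a, b] → M` is a `(lam, kap)`-almost-geodesic. -/
structure IsAlmostGeodesic (M : Set (EuclideanSpace ℂ (Fin d))) (lam kap a b : ℝ)
    (σ : ℝ → EuclideanSpace ℂ (Fin d)) : Prop where
  mapsTo : Set.MapsTo σ (Set.Icc a b) M
  lower : ∀ s ∈ Set.Icc a b, ∀ t ∈ Set.Icc a b,
    (1 / lam) * |t - s| - kap ≤ kobDist M (σ t) (σ s)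
  upper : ∀ s ∈ Set.Icc a b, ∀ t ∈ Set.Icc a b,
    kobDist M (σ t) (σ s) ≤ lam * |t - s| + kap
  absolutelyContinuous : AbsolutelyContinuousOnInterval σ a b
  speed : ∀ᵐ t : ℝ, t ∈ Set.Ioo a b →
    DifferentiableAt ℝ σ t ∧ kobMetric M (σ t) (deriv σ t) ≤ ENNReal.ofReal lam

/-- `σ : [a, b] → M` is a real Kobayashi geodesic: an isometry for `k_M`. -/
structure IsRealGeodesic (M : Set (EuclideanSpace ℂ (Fin d))) (a b : ℝ)
    (σ : ℝ → EuclideanSpace ℂ (Fin d)) : Prop where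
  mapsTo : Set.MapsTo σ (Set.Icc a b) M
  isometry : ∀ s ∈ Set.Icc a b, ∀ t ∈ Set.Icc a b, |s - t| = kobDist M (σ s) (σ t)

/-- Any two distinct points of `M` can be joined by a `(lam, kap)`-almost-geodesic. -/
def JoinedByAlmostGeodesics (M : Set (EuclideanSpace ℂ (Fin d))) (lam kap : ℝ) : Prop :=
  ∀ z ∈ M, ∀ w ∈ M, z ≠ w → ∃ (a b : ℝ) (σ : ℝ → EuclideanSpace ℂ (Fin d)),
    a ≤ b ∧ IsAlmostGeodesic M lam kap a b σ ∧ σ a = z ∧ σ b = w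

/-- The visibility condition for a class `C` of curves `σ : [a, b] → M`: any two distinct boundary
points have neighbourhoods `V`, `W` with disjoint closures and a compact `K ⊆ M` that meets every
curve of the class starting in `V` and ending in `W`. -/
def CurvesVisible (M : Set (EuclideanSpace ℂ (Fin d)))
    (C : ℝ → ℝ → (ℝ → EuclideanSpace ℂ (Fin d)) → Prop) : Prop :=
  ∀ p ∈ bdry M, ∀ q ∈ bdry M, p ≠ q →
    ∃ V ∈ 𝓝 p, ∃ W ∈ 𝓝 q, ∃ K : Set (EuclideanSpace ℂ (Fin d)),
      K ⊆ M ∧ IsCompact K ∧ Disjoint (closure V) (closure W) ∧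
      ∀ (a b : ℝ) (σ : ℝ → EuclideanSpace ℂ (Fin d)), a ≤ b → C a b σ →
        σ a ∈ V → σ b ∈ W → ∃ t ∈ Set.Icc a b, σ t ∈ K

/-- The visibility condition for `(lam, kap)`-almost-geodesics. -/
def AlmostGeodesicsVisible (M : Set (EuclideanSpace ℂ (Fin d))) (lam kap : ℝ) : Prop :=
  CurvesVisible M (IsAlmostGeodesic M lam kap)

/-- `M` is a `(lam, kap)`-visibility submanifold (for `lam ≥ 1`, `kap > 0`). -/
def IsVisibilitySubmanifold (M : Set (EuclideanSpace ℂ (Fin d))) (lam kap : ℝ) : Prop :=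
  JoinedByAlmostGeodesics M lam kap ∧ AlmostGeodesicsVisible M lam kap

/-- `(M, k_M)` is Cauchy-complete. -/
def KobComplete (M : Set (EuclideanSpace ℂ (Fin d))) : Prop :=
  ∀ u : ℕ → EuclideanSpace ℂ (Fin d), (∀ n, u n ∈ M) →
    (∀ ε > 0, ∃ N : ℕ, ∀ m ≥ N, ∀ n ≥ N, kobDist M (u m) (u n) < ε) →
    ∃ x ∈ M, Tendsto (fun n => kobDist M (u n) x) atTop (𝓝 0)

/-- `M` is a BNT-visibility submanifold. -/
def IsBNTVisibilitySubmanifold (M : Set (EuclideanSpace ℂ (Fin d))) : Prop :=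
  KobComplete M ∧ CurvesVisible M (IsRealGeodesic M)

/-- The Gromov product `(x|y)_o` with respect to `k_M`. -/
def gromovProduct (M : Set (EuclideanSpace ℂ (Fin d)))
    (o x y : EuclideanSpace ℂ (Fin d)) : ℝ :=
  (kobDist M x o + kobDist M y o - kobDist M x y) / 2

/-- `limsup (x|y)_o < ∞` as `(x, y) → (p, q)` with `x, y ∈ M`; the limsup is taken in the
extended reals. -/
def GromovProductBoundedAt (M : Set (EuclideanSpace ℂ (Fin d)))
    (o p q : EuclideanSpace ℂ (Fin d)) : Prop :=
  limsup (fun z : EuclideanSpace ℂ (Fin d) × EuclideanSpace ℂ (Fin d) =>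
    ((gromovProduct M o z.1 z.2 : ℝ) : EReal)) (𝓝[M] p ×ˢ 𝓝[M] q) < ⊤

/-- Any two distinct boundary points are separated by a sphere centred at a boundary point and
disjoint from `S`. -/
def SphereSeparated (M S : Set (EuclideanSpace ℂ (Fin d))) : Prop :=
  ∀ p ∈ bdry M, ∀ q ∈ bdry M, p ≠ q → ∃ p' ∈ bdry M, ∃ r : ℝ, 0 < r ∧
    p ∈ Metric.ball p' r ∧ q ∉ Metric.closedBall p' r ∧ S ∩ Metric.sphere p' r = ∅

end KobayashiVisibility

end

open KobayashiVisibility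

namespace KobayashiVisibility

variable {d : ℕ}

/-! Concatenating disc geodesics along a nearly optimal chain of holomorphic discs gives `(1,
κ)`-almost-geodesics between any two points, for every `κ > 0` (`joinedByAlmostGeodesics`). They are
absolutely continuous because, `M` being bounded, the Schwarz lemma makes `k_M` dominate Euclidean
distance (`exists_dist_le_mul_kobDist`). So joinability is automatic, and the content is visibility
versus Gromov products.

If almost-geodesics meet a compact set `K`, then `(x|y)_o` is at most `max_K k_M(·, o)` plus an
error. Conversely, a curve from near `p` to near `q` must cross a thin spherical shell avoiding `S`.
Gromov products of points of the shell at a definite distance apart are uniformly bounded by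
compactness (`exists_gromovProduct_le`), so some point of the crossing is at bounded `k_M`-distance
from `o`. Since `k_M(·, o)` blows up at the boundary points of the shell, that point lies in a fixed
compact subset of `M` (`curvesVisible_of_gromovProductBoundedAt`).

The same crossing lets bounds off `S` control all pairs: along an almost-geodesic, the product of
the endpoints exceeds that of two intermediate points by at most a constant
(`gromovProductBoundedAt_of_diff`). Real geodesics are coarse geodesics with zero error, whence the
last claim. -/

/-! ### The unit disc -/

/-- The automorphism `ζ ↦ (ζ + a) / (1 + ā ζ)` of the unit disc. -/
noncomputable def discAut (a ζ : ℂ) : ℂ := (ζ + a) / (1 + (starRingEnd ℂ) a * ζ)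

/-- The pseudo-hyperbolic distance of the unit disc. -/
noncomputable def pseudoHypDist (a b : ℂ) : ℝ := ‖a - b‖ / ‖1 - (starRingEnd ℂ) a * b‖

theorem one_add_conj_mul_ne_zero {a ζ : ℂ} (ha : ‖a‖ < 1) (hζ : ‖ζ‖ < 1) :
    1 + (starRingEnd ℂ) a * ζ ≠ 0 := by
  intro h
  have h1 : ‖(starRingEnd ℂ) a * ζ‖ = 1 := by
    rw [show (starRingEnd ℂ) a * ζ = -1 by linear_combination h]; simp
  rw [norm_mul, RCLike.norm_conj] at h1
  nlinarith [norm_nonneg a, norm_nonneg ζ]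

/-- Positivity of the right side on the disc is what makes `discAut a` a self-map of the disc. -/
theorem normSq_one_add_conj_mul_sub (a ζ : ℂ) :
    ‖1 + (starRingEnd ℂ) a * ζ‖ ^ 2 - ‖ζ + a‖ ^ 2 = (1 - ‖a‖ ^ 2) * (1 - ‖ζ‖ ^ 2) := by
  simp only [← Complex.normSq_eq_norm_sq, Complex.normSq_apply]
  simp
  ring

theorem norm_discAut_lt_one {a ζ : ℂ} (ha : ‖a‖ < 1) (hζ : ‖ζ‖ < 1) : ‖discAut a ζ‖ < 1 := by
  have h0 := norm_pos_iff.2 (one_add_conj_mul_ne_zero ha hζ)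
  rw [discAut, norm_div, div_lt_one h0]
  have h1 := normSq_one_add_conj_mul_sub a ζ
  have h2 : 0 < (1 - ‖a‖ ^ 2) * (1 - ‖ζ‖ ^ 2) := by
    apply mul_pos <;> nlinarith [norm_nonneg a, norm_nonneg ζ]
  exact lt_of_pow_lt_pow_left₀ 2 h0.le (by linarith)

theorem hasDerivAt_discAut {a ζ : ℂ} (ha : ‖a‖ < 1) (hζ : ‖ζ‖ < 1) :
    HasDerivAt (discAut a)
      ((1 - a * (starRingEnd ℂ) a) / (1 + (starRingEnd ℂ) a * ζ) ^ 2) ζ := by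
  have h0 := one_add_conj_mul_ne_zero ha hζ
  have h1 : HasDerivAt (fun ζ : ℂ => ζ + a) 1 ζ := (hasDerivAt_id ζ).add_const a
  have h2 : HasDerivAt (fun ζ : ℂ => 1 + (starRingEnd ℂ) a * ζ) ((starRingEnd ℂ) a) ζ := by
    simpa using ((hasDerivAt_id ζ).const_mul ((starRingEnd ℂ) a)).const_add 1
  convert! h1.div h2 h0 using 1
  ring

theorem discAut_zero (a : ℂ) : discAut a 0 = a := by simp [discAut]

theorem pseudoHypDist_eq_norm_discAut (a b : ℂ) : pseudoHypDist a b = ‖discAut (-a) b‖ := by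
  rw [pseudoHypDist, discAut, norm_div, norm_sub_rev a b]
  simp [sub_eq_add_neg]

theorem discAut_discAut_neg {a b : ℂ} (ha : ‖a‖ < 1) (hb : ‖b‖ < 1) :
    discAut a (discAut (-a) b) = b := by
  have h1 : 1 + (starRingEnd ℂ) (-a) * b ≠ 0 := one_add_conj_mul_ne_zero (by simpa using ha) hb
  have h2 := one_add_conj_mul_ne_zero ha
    (norm_discAut_lt_one (a := -a) (by simpa using ha) hb)
  have h3 : discAut (-a) b * (1 + (starRingEnd ℂ) (-a) * b) = b + -a := div_mul_cancel₀ _ h1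
  rw [discAut, div_eq_iff h2]
  apply mul_right_cancel₀ h1
  rw [map_neg] at h3 ⊢
  linear_combination (1 - b * (starRingEnd ℂ) a) * h3

theorem pseudoHypDist_lt_one {a b : ℂ} (ha : ‖a‖ < 1) (hb : ‖b‖ < 1) : pseudoHypDist a b < 1 := by
  rw [pseudoHypDist_eq_norm_discAut]
  exact norm_discAut_lt_one (by simpa using ha) hb

theorem pseudoHypDist_nonneg (a b : ℂ) : 0 ≤ pseudoHypDist a b := by
  unfold pseudoHypDist; positivity

theorem poincareDist_eq (a b : ℂ) : poincareDist a b = Real.artanh (pseudoHypDist a b) := rfl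

theorem poincareDist_nonneg (a b : ℂ) : 0 ≤ poincareDist a b :=
  Real.artanh_nonneg (pseudoHypDist_nonneg a b)

theorem poincareDist_comm (a b : ℂ) : poincareDist a b = poincareDist b a := by
  rw [poincareDist, poincareDist, norm_sub_rev a b]
  congr 2
  rw [← RCLike.norm_conj]
  simp [mul_comm]

/-- Follows from `log u ≥ 1 - 1/u`; the factor 2 is not sharp, but any constant serves the Euclidean
comparison. -/
theorem le_two_mul_artanh {x : ℝ} (h0 : 0 ≤ x) (h1 : x < 1) : x ≤ 2 * Real.artanh x := by
  rw [Real.artanh_eq_half_log ⟨by linarith, h1.le⟩]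
  have h2 := Real.one_sub_inv_le_log_of_pos (x := (1 + x) / (1 - x))
    (div_pos (by linarith) (by linarith))
  rw [inv_div] at h2
  have h3 : x ≤ 1 - (1 - x) / (1 + x) := by
    rw [le_sub_iff_add_le, ← le_sub_iff_add_le', div_le_iff₀ (by linarith)]
    nlinarith
  linarith

theorem pseudoHypDist_le {a b : ℂ} (ha : ‖a‖ < 1) (hb : ‖b‖ < 1) :
    pseudoHypDist a b ≤ 2 * poincareDist a b :=
  le_two_mul_artanh (pseudoHypDist_nonneg a b) (pseudoHypDist_lt_one ha hb)

theorem _root_.Real.hasDerivAt_tanh (x : ℝ) : HasDerivAt Real.tanh (1 - Real.tanh x ^ 2) x := by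
  have h := (Real.hasDerivAt_sinh x).div (Real.hasDerivAt_cosh x) (Real.cosh_pos x).ne'
  have he : Real.tanh = fun y => Real.sinh y / Real.cosh y :=
    funext fun y => Real.tanh_eq_sinh_div_cosh y
  rw [he]
  convert! h using 1
  have := (Real.cosh_pos x).ne'
  field_simp

theorem abs_tanh_lt_one (x : ℝ) : ‖((Real.tanh x : ℝ) : ℂ)‖ < 1 := by
  rw [Complex.norm_real, Real.norm_eq_abs, abs_lt]
  exact ⟨Real.neg_one_lt_tanh x, Real.tanh_lt_one x⟩

/-- The subtraction formula for `tanh`: it parametrises the real diameter by Poincaré arc length. -/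
theorem poincareDist_tanh {s t : ℝ} (h : s ≤ t) :
    poincareDist (Real.tanh s : ℂ) (Real.tanh t : ℂ) = t - s := by
  have h1 : Real.tanh (t - s) = (Real.tanh t - Real.tanh s) / (1 - Real.tanh s * Real.tanh t) := by
    have hs := (Real.cosh_pos s).ne'
    have ht := (Real.cosh_pos t).ne'
    simp only [Real.tanh_eq_sinh_div_cosh, Real.sinh_sub, Real.cosh_sub]
    field_simp
  have h2 : 0 ≤ Real.tanh (t - s) := by
    rw [Real.tanh_eq_sinh_div_cosh]
    exact div_nonneg (Real.sinh_nonneg_iff.2 (by linarith)) (Real.cosh_pos _).le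
  have h3 : pseudoHypDist (Real.tanh s : ℂ) (Real.tanh t : ℂ) = Real.tanh (t - s) := by
    rw [← abs_of_nonneg h2, h1, abs_div, pseudoHypDist, norm_sub_rev, Complex.conj_ofReal]
    norm_cast
  rw [poincareDist_eq, h3, Real.artanh_tanh]

/-! ### Holomorphic discs and chains -/

variable {M : Set (EuclideanSpace ℂ (Fin d))}

theorem IsHolomorphicDisc.comp {f : ℂ → EuclideanSpace ℂ (Fin d)} (hf : IsHolomorphicDisc M f)
    {g : ℂ → ℂ} (hg : DifferentiableOn ℂ g (Metric.ball 0 1))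
    (hm : Set.MapsTo g (Metric.ball 0 1) (Metric.ball 0 1)) : IsHolomorphicDisc M (f ∘ g) :=
  ⟨hf.1.comp hg hm, hf.2.comp hm⟩

theorem IsHolomorphicDisc.comp_discAut {f : ℂ → EuclideanSpace ℂ (Fin d)}
    (hf : IsHolomorphicDisc M f) {a : ℂ} (ha : ‖a‖ < 1) : IsHolomorphicDisc M (f ∘ discAut a) := by
  refine hf.comp (fun ζ hζ => ?_) (fun ζ hζ => ?_)
  · exact (hasDerivAt_discAut ha (by simpa using hζ)).differentiableAt.differentiableWithinAt
  · simpa using norm_discAut_lt_one ha (by simpa using hζ)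

/-- Any two points of a holomorphic disc are, up to reparametrization, the images of `0` and of the
pseudo-hyperbolic distance of the parameters. -/
theorem IsHolomorphicDisc.exists_normalization {f : ℂ → EuclideanSpace ℂ (Fin d)}
    (hf : IsHolomorphicDisc M f) {a b : ℂ} (ha : ‖a‖ < 1) (hb : ‖b‖ < 1) :
    ∃ g, IsHolomorphicDisc M g ∧ g 0 = f a ∧ g (pseudoHypDist a b : ℂ) = f b := by
  set c := discAut (-a) b with hc
  -- A rotation moves the second parameter to the positive real axis; for `c = 0` any rotation
  -- works.
  obtain ⟨e, he, hce⟩ : ∃ e : ℂ, ‖e‖ = 1 ∧ (‖c‖ : ℂ) * e = c := by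
    rcases eq_or_ne c 0 with h | h
    · exact ⟨1, by simp, by simp [h]⟩
    · have h' : (‖c‖ : ℂ) ≠ 0 := by simpa using h
      exact ⟨c / ‖c‖, by simp [h], mul_div_cancel₀ _ h'⟩
  refine ⟨(f ∘ discAut a) ∘ fun ζ => ζ * e, (hf.comp_discAut ha).comp ?_ ?_, ?_, ?_⟩
  · fun_prop
  · intro ζ hζ
    simpa [he] using hζ
  · simp [discAut_zero]
  · simp only [Function.comp, pseudoHypDist_eq_norm_discAut, ← hc, hce]
    rw [hc, discAut_discAut_neg ha hb]

theorem DiscChain.nonneg {x y : EuclideanSpace ℂ (Fin d)} {l : ℝ} (h : DiscChain M x y l) :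
    0 ≤ l := by
  induction h with
  | nil => exact le_rfl
  | cons f hf a b ha hb z l h ih => exact add_nonneg (poincareDist_nonneg a b) ih

theorem DiscChain.trans {x y z : EuclideanSpace ℂ (Fin d)} {l m : ℝ} (h : DiscChain M x y l)
    (h' : DiscChain M y z m) : DiscChain M x z (l + m) := by
  induction h with
  | nil => simpa using h'
  | cons f hf a b ha hb w l h ih =>
    rw [add_assoc]
    exact .cons f hf a b ha hb z _ (ih h')

theorem DiscChain.single {f : ℂ → EuclideanSpace ℂ (Fin d)} (hf : IsHolomorphicDisc M f) {a b : ℂ}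
    (ha : ‖a‖ < 1) (hb : ‖b‖ < 1) : DiscChain M (f a) (f b) (poincareDist a b) := by
  have hb' : b ∈ Metric.ball (0 : ℂ) 1 := by simpa using hb
  simpa using DiscChain.cons f hf a b (by simpa using ha) hb' (f b) 0 (.nil _ (hf.2 hb'))

theorem DiscChain.symm {x y : EuclideanSpace ℂ (Fin d)} {l : ℝ} (h : DiscChain M x y l) :
    DiscChain M y x l := by
  induction h with
  | nil x hx => exact .nil x hx
  | cons f hf a b ha hb z l h ih =>
    rw [add_comm, poincareDist_comm]
    exact ih.trans (.single hf (by simpa using hb) (by simpa using ha))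

/-! ### The Kobayashi distance -/

theorem bddBelow_discChain (x y : EuclideanSpace ℂ (Fin d)) :
    BddBelow {l : ℝ | DiscChain M x y l} :=
  ⟨0, fun _ h => DiscChain.nonneg h⟩

theorem kobDist_nonneg (x y : EuclideanSpace ℂ (Fin d)) : 0 ≤ kobDist M x y :=
  Real.sInf_nonneg fun _ h => DiscChain.nonneg h

theorem kobDist_comm (x y : EuclideanSpace ℂ (Fin d)) : kobDist M x y = kobDist M y x := by
  rw [kobDist, kobDist]
  congr 1
  ext l
  exact ⟨DiscChain.symm, DiscChain.symm⟩

theorem kobDist_self (x : EuclideanSpace ℂ (Fin d)) : kobDist M x x = 0 := by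
  refine le_antisymm ?_ (kobDist_nonneg x x)
  by_cases hx : x ∈ M
  · exact csInf_le (bddBelow_discChain x x) (DiscChain.nil x hx)
  -- Chains start in `M`, so off `M` the infimum is over the empty set and equals `0` by convention.
  · by_contra! h
    have hne : {l : ℝ | DiscChain M x x l}.Nonempty := by
      by_contra! he
      rw [kobDist, he, Real.sInf_empty] at h
      exact lt_irrefl _ h
    obtain ⟨l, hl⟩ := hne
    rcases hl with _ | ⟨f, hf, a, b, ha, hb, _, l, h⟩
    · contradiction
    · exact hx (hf.2 ha)

theorem kobDist_le {x y : EuclideanSpace ℂ (Fin d)} {l : ℝ} (h : DiscChain M x y l) :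
    kobDist M x y ≤ l :=
  csInf_le (bddBelow_discChain x y) h

theorem kobDist_disc_le {f : ℂ → EuclideanSpace ℂ (Fin d)} (hf : IsHolomorphicDisc M f) {a b : ℂ}
    (ha : ‖a‖ < 1) (hb : ‖b‖ < 1) : kobDist M (f a) (f b) ≤ poincareDist a b :=
  kobDist_le (.single hf ha hb)

/-- In a flattening chart, points near `x` lie on a common holomorphic disc with `x`. -/
theorem IsEmbeddedComplexSubmanifold.eventually_discChain (hM : IsEmbeddedComplexSubmanifold M)
    {x : EuclideanSpace ℂ (Fin d)} (hx : x ∈ M) :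
    ∀ᶠ y in 𝓝[M] x, DiscChain M x y (Real.artanh (1 / 2)) := by
  obtain ⟨n, -, hM⟩ := hM
  obtain ⟨Φ, hxs, hd, hd', hflat⟩ := hM x hx
  obtain ⟨r, hr, hball⟩ := Metric.isOpen_iff.1 Φ.open_target (Φ x) (Φ.map_source hxs)
  have hcont : ∀ᶠ y in 𝓝[M] x, Φ y ∈ Metric.ball (Φ x) (r / 2) :=
    ((Φ.continuousAt hxs).eventually (Metric.ball_mem_nhds _ (half_pos hr))).filter_mono
      nhdsWithin_le_nhds
  filter_upwards [hcont, self_mem_nhdsWithin,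
    nhdsWithin_le_nhds (Φ.open_source.mem_nhds hxs)] with y hy hyM hys
  -- An affine disc in the flat chart, with `Φ x` at `0` and `Φ y` at `1/2`. The radius `r / 2`
  -- above compensates the factor 2.
  set g : ℂ → EuclideanSpace ℂ (Fin d) := fun ζ => Φ x + (2 * ζ) • (Φ y - Φ x) with hg
  have hgm : Set.MapsTo g (Metric.ball 0 1) Φ.target := by
    intro ζ hζ
    apply hball
    rw [mem_ball_iff_norm, hg]
    rw [mem_ball_iff_norm] at hy hζ
    simp only [add_sub_cancel_left, norm_smul, norm_mul, Complex.norm_ofNat]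
    rw [sub_zero] at hζ
    nlinarith [norm_nonneg ζ, norm_nonneg (Φ y - Φ x)]
  have hf : IsHolomorphicDisc M (Φ.symm ∘ g) := by
    refine ⟨hd'.comp (by fun_prop) hgm, fun ζ hζ => ?_⟩
    refine (hflat _ (Φ.map_target (hgm hζ))).2 fun i hi => ?_
    have h1 := (hflat x hxs).1 hx i hi
    have h2 := (hflat y hys).1 hyM i hi
    rw [Φ.right_inv (hgm hζ)]
    simp [hg, h1, h2]
  have h := DiscChain.single hf (a := 0) (b := 1 / 2) (by simp) (by norm_num)
  have e1 : (Φ.symm ∘ g) 0 = x := by simp [hg, Φ.left_inv hxs]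
  have e2 : (Φ.symm ∘ g) (1 / 2) = y := by simp [hg, Φ.left_inv hys]
  rw [e1, e2] at h
  simpa [poincareDist] using h

/-- Being joined by a chain is an equivalence relation on `M` with open classes, so connectedness
leaves one class. -/
theorem exists_discChain (hM : IsEmbeddedComplexSubmanifold M) (hconn : IsConnected M)
    {x y : EuclideanSpace ℂ (Fin d)} (hx : x ∈ M) (hy : y ∈ M) : ∃ l, DiscChain M x y l :=
  hconn.isPreconnected.induction₂ (fun x y => ∃ l, DiscChain M x y l)
    (fun _ hx => (hM.eventually_discChain hx).mono fun _ h => ⟨_, h⟩)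
    (fun _ _ _ _ _ _ ⟨l, h⟩ ⟨m, h'⟩ => ⟨l + m, h.trans h'⟩)
    (fun _ _ _ _ ⟨l, h⟩ => ⟨l, h.symm⟩) hx hy

theorem exists_discChain_lt (hM : IsEmbeddedComplexSubmanifold M) (hconn : IsConnected M)
    {x y : EuclideanSpace ℂ (Fin d)} (hx : x ∈ M) (hy : y ∈ M) {r : ℝ} (hr : kobDist M x y < r) :
    ∃ l < r, DiscChain M x y l := by
  obtain ⟨l, hl, hlr⟩ := exists_lt_of_csInf_lt (exists_discChain hM hconn hx hy) hr
  exact ⟨l, hlr, hl⟩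

theorem kobDist_triangle (hM : IsEmbeddedComplexSubmanifold M) (hconn : IsConnected M)
    {x y z : EuclideanSpace ℂ (Fin d)} (hx : x ∈ M) (hy : y ∈ M) (hz : z ∈ M) :
    kobDist M x z ≤ kobDist M x y + kobDist M y z := by
  refine le_of_forall_pos_lt_add fun ε hε => ?_
  obtain ⟨l, hl, h⟩ := exists_discChain_lt hM hconn hx hy
    (lt_add_of_pos_right (kobDist M x y) (half_pos hε))
  obtain ⟨m, hm, h'⟩ := exists_discChain_lt hM hconn hy hz
    (lt_add_of_pos_right (kobDist M y z) (half_pos hε))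
  linarith [kobDist_le (h.trans h')]

/-- The Kobayashi distance to a point is bounded on compact subsets. -/
theorem exists_kobDist_le_of_isCompact (hM : IsEmbeddedComplexSubmanifold M)
    (hconn : IsConnected M) {o : EuclideanSpace ℂ (Fin d)} (ho : o ∈ M)
    {K : Set (EuclideanSpace ℂ (Fin d))} (hK : IsCompact K) (hKM : K ⊆ M) :
    ∃ C, ∀ x ∈ K, kobDist M x o ≤ C := by
  refine hK.induction_on (p := fun s => ∃ C, ∀ x ∈ s, kobDist M x o ≤ C) ⟨0, by simp⟩
    (fun s t hst ⟨C, hC⟩ => ⟨C, fun x hx => hC x (hst hx)⟩) ?_ fun x hx => ?_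
  · rintro s t ⟨C, hC⟩ ⟨C', hC'⟩
    refine ⟨max C C', fun x hx => ?_⟩
    rcases hx with hx | hx
    · exact (hC x hx).trans (le_max_left _ _)
    · exact (hC' x hx).trans (le_max_right _ _)
  · have hn := nhdsWithin_mono x hKM (hM.eventually_discChain (hKM hx))
    refine ⟨_, inter_mem hn self_mem_nhdsWithin, Real.artanh (1 / 2) + kobDist M x o, ?_⟩
    rintro y ⟨hy, hyK⟩
    have h1 := kobDist_le (DiscChain.symm hy)
    linarith [kobDist_triangle hM hconn (hKM hyK) (hKM hx) ho]

/-- On a bounded submanifold the Kobayashi distance dominates the Euclidean one. -/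
theorem exists_dist_le_mul_kobDist (hM : IsEmbeddedComplexSubmanifold M) (hconn : IsConnected M)
    (hbdd : Bornology.IsBounded M) :
    ∃ C : NNReal, ∀ x ∈ M, ∀ y ∈ M, dist x y ≤ C * kobDist M x y := by
  obtain ⟨R, hR⟩ := Metric.isBounded_iff.1 hbdd
  have hR0 : 0 ≤ R := by
    obtain ⟨x, hx⟩ := hconn.nonempty
    exact dist_nonneg.trans (hR hx hx)
  have hchain : ∀ {x y : EuclideanSpace ℂ (Fin d)} {l : ℝ}, DiscChain M x y l →
      dist x y ≤ 2 * R * l := by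
    intro x y l h
    induction h with
    | nil => simp
    | cons f hf a b ha hb z l h ih =>
      rw [mem_ball_zero_iff] at ha hb
      obtain ⟨g, hg, hga, hgb⟩ := hf.exists_normalization ha hb
      have h0 : (0 : ℂ) ∈ Metric.ball (0 : ℂ) 1 := by simp
      have hp : (pseudoHypDist a b : ℂ) ∈ Metric.ball (0 : ℂ) 1 := by
        simpa [abs_of_nonneg (pseudoHypDist_nonneg a b)] using pseudoHypDist_lt_one ha hb
      -- Schwarz lemma: the normalised disc maps into the closed ball of radius `R` about its
      -- centre.
      have hs := Complex.dist_le_div_mul_dist_of_mapsTo_ball hg.1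
        (fun ζ hζ => Metric.mem_closedBall.2 (hR (hg.2 hζ) (hg.2 h0))) hp
      rw [hga, hgb, dist_zero_right, Complex.norm_real, Real.norm_eq_abs,
        abs_of_nonneg (pseudoHypDist_nonneg a b), div_one, dist_comm] at hs
      nlinarith [dist_triangle (f a) (f b) z, pseudoHypDist_le ha hb]
  refine ⟨⟨2 * R, by positivity⟩, fun x hx y hy => ?_⟩
  change dist x y ≤ 2 * R * kobDist M x y
  refine le_of_forall_pos_lt_add fun ε hε => ?_
  -- Dividing by `2 * R + 1` instead of `2 * R` covers `R = 0`.
  obtain ⟨l, hl, h⟩ := exists_discChain_lt hM hconn hx hy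
    (lt_add_of_pos_right (kobDist M x y) (show 0 < ε / (2 * R + 1) by positivity))
  have h1 := hchain h
  have h2 : (2 * R + 1) * (ε / (2 * R + 1)) = ε := by field_simp
  have h3 : 0 < ε / (2 * R + 1) := by positivity
  nlinarith

/-! ### Joining points by almost-geodesics -/

/-- Curves on `[0, L]` that do not expand distances from the parameter interval to `k_M` and have
infinitesimal speed at most `1`. -/
structure IsNonexpandingCurve (M : Set (EuclideanSpace ℂ (Fin d))) (L : ℝ)
    (σ : ℝ → EuclideanSpace ℂ (Fin d)) : Prop where
  mapsTo : Set.MapsTo σ (Set.Icc 0 L) M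
  kobDist_le : ∀ s ∈ Set.Icc 0 L, ∀ t ∈ Set.Icc 0 L, s ≤ t → kobDist M (σ s) (σ t) ≤ t - s
  speed : ∀ᵐ t : ℝ, t ∈ Set.Ioo 0 L → ∃ v, HasDerivAt σ v t ∧ kobMetric M (σ t) v ≤ 1

/-- The image of a Poincaré geodesic under a holomorphic disc. -/
theorem IsHolomorphicDisc.isNonexpandingCurve {g : ℂ → EuclideanSpace ℂ (Fin d)}
    (hg : IsHolomorphicDisc M g) (L : ℝ) :
    IsNonexpandingCurve M L fun t => g (Real.tanh t : ℂ) := by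
  refine ⟨fun t _ => hg.2 (by simpa using abs_tanh_lt_one t), fun s _ t _ hst => ?_,
    .of_forall fun t _ => ?_⟩
  · exact (kobDist_disc_le hg (abs_tanh_lt_one s) (abs_tanh_lt_one t)).trans_eq
      (poincareDist_tanh hst)
  · have ht := abs_tanh_lt_one t
    set a : ℂ := (Real.tanh t : ℂ) with ha
    have hga : HasDerivAt g (deriv g a) a :=
      (hg.1.differentiableAt (Metric.isOpen_ball.mem_nhds (by simpa using ht))).hasDerivAt
    have hd : HasDerivAt (fun t => g (Real.tanh t : ℂ))
        (((1 - Real.tanh t ^ 2 : ℝ) : ℂ) • deriv g a) t :=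
      HasDerivAt.scomp t hga (Real.hasDerivAt_tanh t).ofReal_comp
    -- Recentring the disc at `a = tanh t` multiplies its derivative by `1 - a ^ 2`, which is also
    -- the derivative of `tanh`, so `α = 1` is admissible.
    refine ⟨_, hd, sInf_le ⟨1, one_pos, by simp, g ∘ discAut a, hg.comp_discAut ht, ?_, ?_⟩⟩
    · simp [discAut_zero]
    · have h0 : HasDerivAt g (deriv g a) (discAut a 0) := by rwa [discAut_zero]
      have h := HasDerivAt.scomp 0 h0 (hasDerivAt_discAut ht (ζ := 0) (by simp))
      rw [h.deriv, Complex.ofReal_one, one_smul]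
      congr 1
      have hc : (starRingEnd ℂ) a = a := Complex.conj_ofReal _
      have hr : ((1 - Real.tanh t ^ 2 : ℝ) : ℂ) = 1 - a ^ 2 := by rw [ha]; norm_cast
      rw [hc, hr]
      ring

theorem IsNonexpandingCurve.concat (hM : IsEmbeddedComplexSubmanifold M) (hconn : IsConnected M)
    {L₁ L₂ : ℝ} {σ₁ σ₂ : ℝ → EuclideanSpace ℂ (Fin d)} (h₁ : IsNonexpandingCurve M L₁ σ₁)
    (h₂ : IsNonexpandingCurve M L₂ σ₂) (hL₁ : 0 ≤ L₁) (hL₂ : 0 ≤ L₂) (h : σ₁ L₁ = σ₂ 0) :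
    IsNonexpandingCurve M (L₁ + L₂) fun t => if t ≤ L₁ then σ₁ t else σ₂ (t - L₁) := by
  refine ⟨fun t ht => ?_, fun s hs t ht hst => ?_, ?_⟩
  · rcases le_or_gt t L₁ with h1 | h1
    · simpa only [if_pos h1] using h₁.mapsTo ⟨ht.1, h1⟩
    · simpa only [if_neg h1.not_ge] using h₂.mapsTo ⟨by linarith, by linarith [ht.2]⟩
  · rcases le_or_gt t L₁ with h1 | h1
    · have h2 := hst.trans h1
      simpa only [if_pos h1, if_pos h2] using h₁.kobDist_le s ⟨hs.1, h2⟩ t ⟨ht.1, h1⟩ hst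
    · have ht' : t - L₁ ∈ Set.Icc 0 L₂ := ⟨by linarith, by linarith [ht.2]⟩
      rcases le_or_gt s L₁ with h2 | h2
      · simp only [if_neg h1.not_ge, if_pos h2]
        have e1 := h₁.kobDist_le s ⟨hs.1, h2⟩ L₁ ⟨hL₁, le_rfl⟩ h2
        have e2 := h₂.kobDist_le 0 ⟨le_rfl, hL₂⟩ _ ht' ht'.1
        rw [h] at e1
        have e3 := kobDist_triangle hM hconn (h₁.mapsTo ⟨hs.1, h2⟩)
          (h₂.mapsTo ⟨le_rfl, hL₂⟩) (h₂.mapsTo ht')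
        linarith
      · simp only [if_neg h1.not_ge, if_neg h2.not_ge]
        have e := h₂.kobDist_le (s - L₁) ⟨by linarith, by linarith [hs.2]⟩ _ ht' (by linarith)
        linarith
  -- Translation preserves null sets, and the junction time `L₁`, where differentiability may fail,
  -- is itself null.
  · have hshift := (MeasureTheory.measurePreserving_sub_right
      MeasureTheory.volume L₁).quasiMeasurePreserving.ae h₂.speed
    filter_upwards [h₁.speed, hshift, MeasureTheory.Measure.ae_ne MeasureTheory.volume L₁]
      with t hs1 hs2 hne ht
    rcases lt_or_gt_of_ne hne with h1 | h1
    · obtain ⟨v, hv, hk⟩ := hs1 ⟨ht.1, h1⟩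
      refine ⟨v, hv.congr_of_eventuallyEq ?_, by rwa [if_pos h1.le]⟩
      filter_upwards [Iio_mem_nhds h1] with u hu using if_pos (le_of_lt hu)
    · obtain ⟨v, hv, hk⟩ := hs2 ⟨by linarith, by linarith [ht.2]⟩
      refine ⟨v, (hv.comp_sub_const t L₁).congr_of_eventuallyEq ?_, by rwa [if_neg h1.not_ge]⟩
      filter_upwards [Ioi_mem_nhds h1] with u hu using if_neg (not_le_of_gt hu)

theorem DiscChain.exists_isNonexpandingCurve (hM : IsEmbeddedComplexSubmanifold M)
    (hconn : IsConnected M) {x y : EuclideanSpace ℂ (Fin d)} {l : ℝ} (h : DiscChain M x y l) :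
    ∃ σ, IsNonexpandingCurve M l σ ∧ σ 0 = x ∧ σ l = y := by
  induction h with
  | nil x hx =>
    refine ⟨fun _ => x, ⟨fun _ _ => hx, fun s _ t _ hst => ?_, .of_forall fun t ht => ?_⟩, rfl, rfl⟩
    · rw [kobDist_self]; linarith
    · exact absurd (ht.1.trans ht.2) (lt_irrefl _)
  | cons f hf a b ha hb z l h ih =>
    rw [mem_ball_zero_iff] at ha hb
    obtain ⟨σ, hσ, h0, hl⟩ := ih
    obtain ⟨g, hg, hga, hgb⟩ := hf.exists_normalization ha hb
    have e : g (Real.tanh (poincareDist a b) : ℂ) = f b := by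
      rw [poincareDist_eq, Real.tanh_artanh
        ⟨by linarith [pseudoHypDist_nonneg a b], pseudoHypDist_lt_one ha hb⟩, hgb]
    refine ⟨_, (hg.isNonexpandingCurve (poincareDist a b)).concat hM hconn hσ
      (poincareDist_nonneg a b) h.nonneg (e.trans h0.symm), ?_, ?_⟩
    · simp [poincareDist_nonneg, hga]
    -- If the remaining chain has length zero, the endpoint still falls under the first branch of
    -- the `if`.
    · rcases h.nonneg.eq_or_lt with h1 | h1
      · subst h1
        simp only [add_zero, le_refl, if_true]
        rw [e, ← h0, hl]
      · simp [h1.not_ge, hl]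

/-- A nonexpanding curve whose length exceeds the distance of its endpoints by less than `kap` loses
less than `kap` on every subinterval, by the triangle inequality. -/
theorem joinedByAlmostGeodesics (hM : IsEmbeddedComplexSubmanifold M) (hconn : IsConnected M)
    (hbdd : Bornology.IsBounded M) {kap : ℝ} (hkap : 0 < kap) :
    JoinedByAlmostGeodesics M 1 kap := by
  intro x hx y hy _
  obtain ⟨l, hl, hchain⟩ := exists_discChain_lt hM hconn hx hy
    (lt_add_of_pos_right (kobDist M x y) hkap)
  obtain ⟨σ, hσ, h0, h1⟩ := hchain.exists_isNonexpandingCurve hM hconn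
  obtain ⟨C, hC⟩ := exists_dist_le_mul_kobDist hM hconn hbdd
  have hl0 := hchain.nonneg
  have hup : ∀ s ∈ Set.Icc 0 l, ∀ t ∈ Set.Icc 0 l, kobDist M (σ t) (σ s) ≤ |t - s| := by
    intro s hs t ht
    rcases le_total s t with h | h
    · rw [kobDist_comm, abs_of_nonneg (by linarith)]
      exact hσ.kobDist_le s hs t ht h
    · rw [abs_sub_comm, abs_of_nonneg (by linarith)]
      exact hσ.kobDist_le t ht s hs h
  have hlow : ∀ s ∈ Set.Icc 0 l, ∀ t ∈ Set.Icc 0 l, s ≤ t →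
      t - s - kap ≤ kobDist M (σ s) (σ t) := by
    intro s hs t ht h
    have e0 : (0 : ℝ) ∈ Set.Icc 0 l := ⟨le_rfl, hl0⟩
    have el : l ∈ Set.Icc 0 l := ⟨hl0, le_rfl⟩
    have e1 := hσ.kobDist_le 0 e0 s hs hs.1
    have e2 := hσ.kobDist_le t ht l el ht.2
    have e3 := kobDist_triangle hM hconn (hσ.mapsTo e0) (hσ.mapsTo hs) (hσ.mapsTo el)
    have e4 := kobDist_triangle hM hconn (hσ.mapsTo hs) (hσ.mapsTo ht) (hσ.mapsTo el)
    rw [h0, h1] at e3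
    rw [h0] at e1
    rw [h1] at e2 e4
    linarith
  refine ⟨0, l, σ, hl0, ⟨hσ.mapsTo, fun s hs t ht => ?_, fun s hs t ht => ?_, ?_, ?_⟩, h0, h1⟩
  · rw [div_one, one_mul]
    rcases le_total s t with h | h
    · rw [kobDist_comm, abs_of_nonneg (by linarith)]
      exact hlow s hs t ht h
    · rw [abs_sub_comm, abs_of_nonneg (by linarith)]
      exact hlow t ht s hs h
  · linarith [hup s hs t ht]
  · refine LipschitzOnWith.absolutelyContinuousOnInterval (K := C) ?_
    rw [Set.uIcc_of_le hl0]
    refine LipschitzOnWith.of_dist_le_mul fun t ht s hs => ?_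
    exact (hC _ (hσ.mapsTo ht) _ (hσ.mapsTo hs)).trans
      (mul_le_mul_of_nonneg_left (hup s hs t ht) C.2)
  · filter_upwards [hσ.speed] with t ht hmem
    obtain ⟨v, hv, hk⟩ := ht hmem
    exact ⟨hv.differentiableAt, by rwa [hv.deriv, ENNReal.ofReal_one]⟩

/-! ### Crossing lemmas on intervals -/

/-- A continuous function passing from below `r'` to above `r` has a crossing of `[r', r]`. -/
theorem exists_crossing {φ : ℝ → ℝ} {a b r' r : ℝ} (hab : a ≤ b)
    (hφ : ContinuousOn φ (Set.Icc a b)) (ha : φ a ≤ r') (hr : r' < r) (hb : r ≤ φ b) :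
    ∃ s t, a ≤ s ∧ s ≤ t ∧ t ≤ b ∧ φ s = r' ∧ φ t = r ∧
      ∀ u ∈ Set.Icc s t, r' ≤ φ u ∧ φ u ≤ r := by
  -- Take `t` as the first time at level at least `r`, then `s` as the last time before `t` at level
  -- at most `r'`.
  obtain ⟨t, ⟨⟨hat, htb⟩, htr⟩, htmin⟩ :=
    (hφ.preimage_isClosed_of_isClosed isClosed_Icc isClosed_Ici |> fun h =>
      isCompact_Icc.of_isClosed_subset h Set.inter_subset_left).exists_isLeast
      ⟨b, ⟨hab, le_rfl⟩, hb⟩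
  have hφt : ContinuousOn φ (Set.Icc a t) := hφ.mono (Set.Icc_subset_Icc_right htb)
  have hteq : φ t = r := by
    obtain ⟨u, hu, hur⟩ := intermediate_value_Icc hat hφt ⟨ha.trans hr.le, htr⟩
    have : t ≤ u := htmin ⟨⟨hu.1, hu.2.trans htb⟩, hur.ge⟩
    rwa [le_antisymm hu.2 this] at hur
  obtain ⟨s, ⟨⟨has, hst⟩, hsr⟩, hsmax⟩ :=
    (hφt.preimage_isClosed_of_isClosed isClosed_Icc isClosed_Iic |> fun h =>
      isCompact_Icc.of_isClosed_subset h Set.inter_subset_left).exists_isGreatest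
      ⟨a, ⟨le_rfl, hat⟩, ha⟩
  have hseq : φ s = r' := by
    obtain ⟨u, hu, hur⟩ := intermediate_value_Icc hst
      (hφt.mono (Set.Icc_subset_Icc_left has)) ⟨hsr, hr.le.trans htr⟩
    have : u ≤ s := hsmax ⟨⟨has.trans hu.1, hu.2⟩, hur.le⟩
    rwa [le_antisymm this hu.1] at hur
  refine ⟨s, t, has, hst, htb, hseq, hteq, fun u hu => ⟨?_, ?_⟩⟩
  · by_contra! h
    have : u ≤ s := hsmax ⟨⟨has.trans hu.1, hu.2⟩, h.le⟩
    rw [le_antisymm this hu.1, hseq] at h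
    exact lt_irrefl _ h
  · by_contra! h
    have : t ≤ u := htmin ⟨⟨has.trans hu.1, hu.2.trans htb⟩, h.le⟩
    rw [le_antisymm hu.2 this, hteq] at h
    exact lt_irrefl _ h

/-- A property that holds at the left and fails at the right end of an interval holds and fails at
points at distance at most `2`. -/
theorem exists_close_switch {P : ℝ → Prop} {s t : ℝ} (hst : s ≤ t) (hs : P s) (ht : ¬ P t) :
    ∃ u ∈ Set.Icc s t, ∃ v ∈ Set.Icc s t, u ≤ v ∧ v ≤ u + 2 ∧ P u ∧ ¬ P v := by
  -- No continuity of `P` is available: `u` is chosen within 1 below `sSup E`, and `v` is `sSup E +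
  -- 1`, or `t` if that comes first.
  set E := {u ∈ Set.Icc s t | P u} with hE
  have hne : E.Nonempty := ⟨s, ⟨le_rfl, hst⟩, hs⟩
  have hbd : BddAbove E := ⟨t, fun u hu => hu.1.2⟩
  obtain ⟨u, hu, hlt⟩ := exists_lt_of_lt_csSup hne (sub_one_lt (sSup E))
  have hu' : u ≤ sSup E := le_csSup hbd hu
  have hsup : sSup E ≤ t := csSup_le hne fun u hu => hu.1.2
  rcases le_or_gt t (sSup E + 1) with h | h
  · exact ⟨u, hu.1, t, ⟨hst, le_rfl⟩, hu.1.2, by linarith, hu.2, ht⟩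
  · have hmem : sSup E + 1 ∈ Set.Icc s t := ⟨by linarith [hu.1.1], h.le⟩
    refine ⟨u, hu.1, sSup E + 1, hmem, by linarith, by linarith, hu.2, fun hP => ?_⟩
    linarith [le_csSup hbd (show sSup E + 1 ∈ E from ⟨hmem, hP⟩)]

/-! ### Gromov products -/

theorem gromovProduct_comm (o x y : EuclideanSpace ℂ (Fin d)) :
    gromovProduct M o x y = gromovProduct M o y x := by
  rw [gromovProduct, gromovProduct, kobDist_comm x y]
  ring

/-- An extended-real limsup below `⊤` leaves room for a real number in between, which is an eventual
bound. -/
theorem gromovProductBoundedAt_iff {o p q : EuclideanSpace ℂ (Fin d)} :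
    GromovProductBoundedAt M o p q ↔
      ∃ C : ℝ, ∀ᶠ z in 𝓝[M ×ˢ M] (p, q), gromovProduct M o z.1 z.2 ≤ C := by
  rw [GromovProductBoundedAt, nhdsWithin_prod_eq]
  constructor
  · intro h
    obtain ⟨C, hC, -⟩ := EReal.lt_iff_exists_real_btwn.1 h
    refine ⟨C, (eventually_lt_of_limsup_lt hC).mono fun z hz => ?_⟩
    exact le_of_lt (by exact_mod_cast hz)
  · rintro ⟨C, hC⟩
    refine (limsup_le_of_le (by isBoundedDefault) (a := (C : EReal)) ?_).trans_lt
      (EReal.coe_lt_top C)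
    exact hC.mono fun z hz => by exact_mod_cast hz

theorem gromovProduct_le_kobDist (hM : IsEmbeddedComplexSubmanifold M) (hconn : IsConnected M)
    {o x y : EuclideanSpace ℂ (Fin d)} (ho : o ∈ M) (hx : x ∈ M) (hy : y ∈ M) :
    gromovProduct M o x y ≤ kobDist M x o := by
  have h := kobDist_triangle hM hconn hy hx ho
  rw [kobDist_comm y x] at h
  rw [gromovProduct]
  linarith

/-- Away from the diagonal of a compact set, Gromov products are uniformly bounded as soon as they
are bounded near pairs of distinct boundary points. -/
theorem exists_gromovProduct_le (hM : IsEmbeddedComplexSubmanifold M) (hconn : IsConnected M)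
    {o : EuclideanSpace ℂ (Fin d)} (ho : o ∈ M) {A : Set (EuclideanSpace ℂ (Fin d))}
    (hA : IsCompact A) (hAM : A ⊆ closure M)
    (hG : ∀ p ∈ bdry M ∩ A, ∀ q ∈ bdry M ∩ A, p ≠ q → GromovProductBoundedAt M o p q)
    {δ : ℝ} (hδ : 0 < δ) :
    ∃ C : ℝ, 0 ≤ C ∧ ∀ x ∈ M ∩ A, ∀ y ∈ M ∩ A, δ ≤ dist x y → gromovProduct M o x y ≤ C := by
  -- Pairs with a coordinate in `M` need no hypothesis: the product is at most the distance from
  -- that coordinate to `o`, whatever the other one is.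
  have hnear : ∀ x ∈ M, ∃ C, ∀ᶠ x' in 𝓝[M] x, ∀ y ∈ M, gromovProduct M o x' y ≤ C := by
    intro x hx
    refine ⟨Real.artanh (1 / 2) + kobDist M x o, ?_⟩
    filter_upwards [hM.eventually_discChain hx, self_mem_nhdsWithin] with x' hx' hx'M y hy
    have h1 := kobDist_le hx'.symm
    linarith [gromovProduct_le_kobDist hM hconn ho hx'M hy,
      kobDist_triangle hM hconn hx'M hx ho]
  have hD : IsCompact ((A ×ˢ A) ∩ {z | δ ≤ dist z.1 z.2}) :=
    (hA.prod hA).inter_right (isClosed_le continuous_const (by fun_prop))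
  have key : ∃ C, ∀ z ∈ (A ×ˢ A) ∩ {z | δ ≤ dist z.1 z.2}, z ∈ M ×ˢ M →
      gromovProduct M o z.1 z.2 ≤ C := by
    refine hD.induction_on (p := fun s => ∃ C, ∀ z ∈ s, z ∈ M ×ˢ M →
      gromovProduct M o z.1 z.2 ≤ C) ⟨0, by simp⟩
      (fun s t hst ⟨C, hC⟩ => ⟨C, fun z hz => hC z (hst hz)⟩) ?_ ?_
    · rintro s t ⟨C, hC⟩ ⟨C', hC'⟩
      refine ⟨max C C', fun z hz hzM => ?_⟩
      rcases hz with hz | hz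
      · exact (hC z hz hzM).trans (le_max_left _ _)
      · exact (hC' z hz hzM).trans (le_max_right _ _)
    · rintro ⟨p, q⟩ ⟨⟨hp, hq⟩, hpq⟩
      have hne : p ≠ q := by
        rintro rfl
        have : δ ≤ dist p p := hpq
        rw [dist_self] at this
        linarith
      suffices h : ∃ C, ∀ᶠ z in 𝓝[M ×ˢ M] (p, q), gromovProduct M o z.1 z.2 ≤ C by
        obtain ⟨C, hC⟩ := h
        exact ⟨_, nhdsWithin_le_nhds (eventually_nhdsWithin_iff.1 hC), C, fun z hz hzM => hz hzM⟩
      by_cases hpM : p ∈ M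
      · obtain ⟨C, hC⟩ := hnear p hpM
        refine ⟨C, ?_⟩
        rw [nhdsWithin_prod_eq]
        filter_upwards [hC.prod_mk (eventually_mem_nhdsWithin (a := q))] with z hz using hz.1 _ hz.2
      · by_cases hqM : q ∈ M
        · obtain ⟨C, hC⟩ := hnear q hqM
          refine ⟨C, ?_⟩
          rw [nhdsWithin_prod_eq]
          filter_upwards [(eventually_mem_nhdsWithin (a := p)).prod_mk hC] with z hz
          rw [gromovProduct_comm]
          exact hz.2 _ hz.1
        · exact gromovProductBoundedAt_iff.1
            (hG p ⟨⟨hAM hp, hpM⟩, hp⟩ q ⟨⟨hAM hq, hqM⟩, hq⟩ hne)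
  obtain ⟨C, hC⟩ := key
  exact ⟨max C 0, le_max_right _ _, fun x hx y hy hxy =>
    (hC (x, y) ⟨⟨hx.2, hy.2⟩, hxy⟩ ⟨hx.1, hy.1⟩).trans (le_max_left _ _)⟩

/-! ### Separation by spherical shells -/

theorem isClosed_shell {E : Type*} [PseudoMetricSpace E] (c : E) (r' r : ℝ) :
    IsClosed {z | r' ≤ dist z c ∧ dist z c ≤ r} := by
  have h1 : IsClosed {z | r' ≤ dist z c} := isClosed_le (by fun_prop) (by fun_prop)
  have h2 : IsClosed {z | dist z c ≤ r} := isClosed_le (by fun_prop) (by fun_prop)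
  exact h1.inter h2

/-- Spheres avoiding `S` can be thickened inwards to spherical shells avoiding `S`. -/
theorem SphereSeparated.exists_shell {S : Set (EuclideanSpace ℂ (Fin d))}
    (hsep : SphereSeparated M S) (hS : IsCompact S) {p q : EuclideanSpace ℂ (Fin d)}
    (hp : p ∈ bdry M) (hq : q ∈ bdry M) (hpq : p ≠ q) :
    ∃ (c : EuclideanSpace ℂ (Fin d)) (r' r : ℝ), r' < r ∧ dist p c < r' ∧ r < dist q c ∧
      ∀ z, r' ≤ dist z c → dist z c ≤ r → z ∉ S := by
  obtain ⟨c, -, r, -, hpc, hqc, hSc⟩ := hsep p hp q hq hpq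
  rw [Metric.mem_ball] at hpc
  rw [Metric.mem_closedBall, not_le] at hqc
  have hK : IsClosed ((fun z => dist z c) '' S) :=
    (hS.image (continuous_id.dist continuous_const)).isClosed
  have hr : r ∈ ((fun z => dist z c) '' S)ᶜ := by
    rintro ⟨z, hz, hzr⟩
    exact Set.notMem_empty z (hSc ▸ ⟨hz, hzr⟩)
  obtain ⟨ε, hε, hball⟩ := Metric.isOpen_iff.1 hK.isOpen_compl r hr
  -- The first entry keeps the shell inside the gap of width `ε` around `r` free of distances from
  -- `S`; the second keeps `p` inside the inner sphere.
  refine ⟨c, max (r - ε / 2) ((dist p c + r) / 2), r, max_lt (by linarith) (by linarith),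
    lt_max_of_lt_right (by linarith), hqc, fun z h1 h2 hz => ?_⟩
  refine hball (show dist z c ∈ Metric.ball r ε from ?_) ⟨z, hz, rfl⟩
  rw [Metric.mem_ball, Real.dist_eq, abs_lt]
  have := (le_max_left _ _).trans h1
  constructor <;> linarith

/-! ### The main implications -/

/-- A `(1,1)`-almost-geodesic from `x` to `y` crosses a shell avoiding `S`. There the hypothesis
bounds the product of the entry and exit points, and that bound passes to `x` and `y`. -/
theorem gromovProductBoundedAt_of_diff (hM : IsEmbeddedComplexSubmanifold M)
    (hconn : IsConnected M) (hbdd : Bornology.IsBounded M) {S : Set (EuclideanSpace ℂ (Fin d))}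
    (hS : IsCompact S) (hsep : SphereSeparated M S) {o : EuclideanSpace ℂ (Fin d)} (ho : o ∈ M)
    (hG : ∀ p ∈ bdry M \ S, ∀ q ∈ bdry M \ S, p ≠ q → GromovProductBoundedAt M o p q)
    {p q : EuclideanSpace ℂ (Fin d)} (hp : p ∈ bdry M) (hq : q ∈ bdry M) (hpq : p ≠ q) :
    GromovProductBoundedAt M o p q := by
  obtain ⟨c, r', r, hr, hpc, hqc, hshell⟩ := hsep.exists_shell hS hp hq hpq
  have hcl : IsClosed {z : EuclideanSpace ℂ (Fin d) | r' ≤ dist z c ∧ dist z c ≤ r} :=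
    isClosed_shell c r' r
  obtain ⟨C, -, hC⟩ := exists_gromovProduct_le hM hconn ho
    (hbdd.isCompact_closure.inter_right hcl) Set.inter_subset_left
    (fun p hp q hq hpq => hG p ⟨hp.1, hshell p hp.2.2.1 hp.2.2.2⟩ q
      ⟨hq.1, hshell q hq.2.2.1 hq.2.2.2⟩ hpq) (sub_pos.2 hr)
  rw [gromovProductBoundedAt_iff]
  -- Four almost-geodesic estimates cost 1 each, and the Gromov product halves the total.
  refine ⟨C + 2, ?_⟩
  rw [nhdsWithin_prod_eq]
  have hV : {z | dist z c < r'} ∈ 𝓝[M] p := nhdsWithin_le_nhds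
    ((isOpen_lt (by fun_prop) continuous_const).mem_nhds hpc)
  have hW : {z | r < dist z c} ∈ 𝓝[M] q := nhdsWithin_le_nhds
    ((isOpen_lt continuous_const (by fun_prop)).mem_nhds hqc)
  filter_upwards [prod_mem_prod (inter_mem hV self_mem_nhdsWithin)
    (inter_mem hW self_mem_nhdsWithin)]
  rintro ⟨x, y⟩ ⟨⟨hx, hxM⟩, hy, hyM⟩
  simp only [Set.mem_ofPred_eq] at hx hy
  have hxy : x ≠ y := by rintro rfl; linarith
  obtain ⟨a, b, σ, hab, hσ, rfl, rfl⟩ :=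
    joinedByAlmostGeodesics hM hconn hbdd one_pos x hxM y hyM hxy
  have hcont : ContinuousOn σ (Set.Icc a b) := by
    simpa [Set.uIcc_of_le hab] using hσ.absolutelyContinuous.continuousOn
  obtain ⟨s, t, has, hst, htb, hs, ht, -⟩ := exists_crossing hab
    (φ := fun u => dist (σ u) c) (by fun_prop) hx.le hr hy.le
  have ma : a ∈ Set.Icc a b := ⟨le_rfl, hab⟩
  have mb : b ∈ Set.Icc a b := ⟨hab, le_rfl⟩
  have ms : s ∈ Set.Icc a b := ⟨has, hst.trans htb⟩
  have mt : t ∈ Set.Icc a b := ⟨has.trans hst, htb⟩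
  have hsM := hσ.mapsTo ms
  have htM := hσ.mapsTo mt
  have hg := hC (σ s) ⟨hsM, subset_closure hsM, hs.ge, hs.trans_le hr.le⟩ (σ t)
    ⟨htM, subset_closure htM, hr.le.trans ht.ge, ht.le⟩ (by
      have := dist_triangle_left (σ t) c (σ s)
      have h2 := dist_comm (σ s) c
      linarith [dist_triangle (σ t) (σ s) c, dist_comm (σ s) (σ t)])
  have e1 := hσ.upper a ma s ms
  have e2 := hσ.upper s ms t mt
  have e3 := hσ.upper t mt b mb
  have e4 := hσ.lower a ma b mb
  have f1 := kobDist_triangle hM hconn hxM hsM ho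
  have f2 := kobDist_triangle hM hconn hyM htM ho
  rw [abs_of_nonneg (by linarith)] at e1 e2 e3 e4
  rw [kobDist_comm (σ s)] at e1
  rw [kobDist_comm (σ t)] at e2
  rw [kobDist_comm (σ b) (σ a)] at e4
  simp only [gromovProduct] at hg ⊢
  linarith

/-- Bounded Gromov products force coarse geodesics to be visible. -/
theorem curvesVisible_of_gromovProductBoundedAt (hM : IsEmbeddedComplexSubmanifold M)
    (hconn : IsConnected M) (hbdd : Bornology.IsBounded M) {S : Set (EuclideanSpace ℂ (Fin d))}
    (hS : IsCompact S) (hsep : SphereSeparated M S) {o : EuclideanSpace ℂ (Fin d)} (ho : o ∈ M)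
    (hinf : ∀ p ∈ bdry M \ S, Tendsto (fun z => kobDist M z o) (𝓝[M] p) atTop)
    (hG : ∀ p ∈ bdry M, ∀ q ∈ bdry M, p ≠ q → GromovProductBoundedAt M o p q)
    {kap : ℝ} (hkap : 0 ≤ kap) {𝒞 : ℝ → ℝ → (ℝ → EuclideanSpace ℂ (Fin d)) → Prop}
    (h𝒞 : ∀ a b σ, a ≤ b → 𝒞 a b σ → ContinuousOn σ (Set.Icc a b) ∧
      Set.MapsTo σ (Set.Icc a b) M ∧ ∀ s ∈ Set.Icc a b, ∀ t ∈ Set.Icc a b, s ≤ t →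
        t - s - kap ≤ kobDist M (σ s) (σ t) ∧ kobDist M (σ s) (σ t) ≤ t - s + kap) :
    CurvesVisible M 𝒞 := by
  intro p hp q hq hpq
  obtain ⟨c, r', r, hr, hpc, hqc, hshell⟩ := hsep.exists_shell hS hp hq hpq
  obtain ⟨C, hC0, hC⟩ := exists_gromovProduct_le hM hconn ho hbdd.isCompact_closure subset_rfl
    (fun p hp q hq hpq => hG p hp.1 q hq.1 hpq) (show 0 < (r - r') / 2 by linarith)
  have hcl : IsClosed {z : EuclideanSpace ℂ (Fin d) | r' ≤ dist z c ∧ dist z c ≤ r} :=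
    isClosed_shell c r' r
  -- The final estimate needs `2 * C + 2 + 5 / 2 * kap`, where the 2 comes from the step length in
  -- `exists_close_switch`.
  set R := 2 * C + 2 + 3 * kap with hR
  set N := {z | z ∈ M ∧ (r' ≤ dist z c ∧ dist z c ≤ r) ∧ kobDist M z o ≤ R} with hN
  -- A limit point outside `M` would lie in the shell, hence off `S`, where the distance to `o`
  -- cannot stay below `R`.
  have hNM : closure N ⊆ M := by
    intro z hz
    by_contra hzM
    have h1 : r' ≤ dist z c ∧ dist z c ≤ r := closure_minimal (fun z hz => hz.2.1) hcl hz
    have h2 := hinf z ⟨⟨closure_mono (fun z hz => hz.1) hz, hzM⟩, hshell z h1.1 h1.2⟩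
    have h3 := eventually_nhdsWithin_iff.1 (h2.eventually_gt_atTop R)
    obtain ⟨w, hw, hwN⟩ := (h3.and_frequently (mem_closure_iff_frequently.1 hz)).exists
    exact absurd (hw hwN.1) hwN.2.2.not_gt
  refine ⟨{z | dist z c < r'}, (isOpen_lt (by fun_prop) continuous_const).mem_nhds hpc,
    {z | r < dist z c}, (isOpen_lt continuous_const (by fun_prop)).mem_nhds hqc, closure N, hNM,
    (hbdd.subset fun z hz => hz.1).isCompact_closure, ?_, ?_⟩
  · refine Set.disjoint_left.2 fun z h1 h2 => ?_
    have e1 : dist z c ≤ r' := closure_lt_subset_le (by fun_prop) (by fun_prop) h1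
    have e2 : r ≤ dist z c := closure_lt_subset_le (by fun_prop) (by fun_prop) h2
    linarith
  · intro a b σ hab hσ ha hb
    simp only [Set.mem_ofPred_eq] at ha hb
    obtain ⟨hcont, hmaps, hgeo⟩ := h𝒞 a b σ hab hσ
    obtain ⟨s, t, has, hst, htb, hs, ht, hsh⟩ := exists_crossing hab
      (φ := fun u => dist (σ u) c) (by fun_prop) ha.le hr hb.le
    have hsub : Set.Icc s t ⊆ Set.Icc a b := Set.Icc_subset_Icc has htb
    have ms : s ∈ Set.Icc s t := ⟨le_rfl, hst⟩
    have mt : t ∈ Set.Icc s t := ⟨hst, le_rfl⟩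
    suffices h : ∃ u ∈ Set.Icc s t, kobDist M (σ u) o ≤ R by
      obtain ⟨u, hu, huR⟩ := h
      exact ⟨u, hsub hu, subset_closure ⟨hmaps (hsub hu), hsh u hu, huR⟩⟩
    have hmem : ∀ u ∈ Set.Icc s t, σ u ∈ M ∩ closure M := fun u hu =>
      ⟨hmaps (hsub hu), subset_closure (hmaps (hsub hu))⟩
    have hdist : r - r' ≤ dist (σ s) (σ t) := by
      linarith [dist_triangle (σ t) (σ s) c, dist_comm (σ s) (σ t)]
    by_cases hsR : kobDist M (σ s) o ≤ R
    · exact ⟨s, ms, hsR⟩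
    -- The product with `σ s` is large at `s` and small at `t`. At the switch, `σ u` is still
    -- Euclidean-close to `σ s`, hence far from `σ t`, while the nearby `σ v` has small product with
    -- `σ s`. So both `(σ s|σ u)_o` and `(σ u|σ t)_o` are bounded; adding them along a coarse
    -- geodesic bounds `k_M(σ u, o)`.
    · obtain ⟨u, hu, v, hv, huv, hvu, hPu, hPv⟩ :=
        exists_close_switch (P := fun u => C < gromovProduct M o (σ s) (σ u)) hst
        (by
          simp only [gromovProduct, kobDist_self]
          linarith)
        (hC _ (hmem s ms) _ (hmem t mt) (by linarith)).not_gt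
      have hlt : dist (σ s) (σ u) < (r - r') / 2 := by
        by_contra! h
        exact hPu.not_ge (hC _ (hmem s ms) _ (hmem u hu) h)
      have e1 := hC _ (hmem u hu) _ (hmem t mt)
        (by linarith [dist_triangle (σ s) (σ u) (σ t)])
      have e2 := (hgeo u (hsub hu) v (hsub hv) huv).2
      have e3 := (hgeo s (hsub ms) u (hsub hu) hu.1).2
      have e4 := (hgeo u (hsub hu) t (hsub mt) hu.2).2
      have e5 := (hgeo s (hsub ms) t (hsub mt) hst).1
      have f1 := kobDist_triangle hM hconn (hmem s ms).1 (hmem u hu).1 (hmem v hv).1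
      have f2 := kobDist_triangle hM hconn (hmem u hu).1 (hmem v hv).1 ho
      have f3 := kobDist_triangle hM hconn (hmem s ms).1 (hmem v hv).1 (hmem u hu).1
      have f4 := kobDist_triangle hM hconn (hmem s ms).1 ho (hmem t mt).1
      rw [kobDist_comm (σ v) (σ u)] at f3
      rw [kobDist_comm o] at f4
      refine ⟨u, hu, ?_⟩
      simp only [gromovProduct, not_lt] at hPv e1
      linarith

/-- Passing through a point of `K` makes `k_M(x, y)` nearly the sum of the distances to that point.
Three errors `kap`, halved, give the `3 / 2`. -/
theorem gromovProductBoundedAt_of_isVisibilitySubmanifold (hM : IsEmbeddedComplexSubmanifold M)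
    (hconn : IsConnected M) {kap : ℝ} (hvis : IsVisibilitySubmanifold M 1 kap)
    {o : EuclideanSpace ℂ (Fin d)} (ho : o ∈ M) {p q : EuclideanSpace ℂ (Fin d)}
    (hp : p ∈ bdry M) (hq : q ∈ bdry M) (hpq : p ≠ q) : GromovProductBoundedAt M o p q := by
  obtain ⟨V, hV, W, hW, K, hKM, hK, hVW, hcurve⟩ := hvis.2 p hp q hq hpq
  obtain ⟨C, hC⟩ := exists_kobDist_le_of_isCompact hM hconn ho hK hKM
  rw [gromovProductBoundedAt_iff]
  refine ⟨C + 3 / 2 * kap, ?_⟩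
  rw [nhdsWithin_prod_eq]
  filter_upwards [prod_mem_prod (inter_mem (nhdsWithin_le_nhds hV) self_mem_nhdsWithin)
    (inter_mem (nhdsWithin_le_nhds hW) self_mem_nhdsWithin)]
  rintro ⟨x, y⟩ ⟨⟨hx, hxM⟩, hy, hyM⟩
  have hxy : x ≠ y := by
    rintro rfl
    exact Set.disjoint_left.1 hVW (subset_closure hx) (subset_closure hy)
  obtain ⟨a, b, σ, hab, hσ, rfl, rfl⟩ := hvis.1 x hxM y hyM hxy
  obtain ⟨t, ht, htK⟩ := hcurve a b σ hab hσ hx hy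
  have e1 := hσ.upper a ⟨le_rfl, hab⟩ t ht
  have e2 := hσ.upper t ht b ⟨hab, le_rfl⟩
  have e3 := hσ.lower a ⟨le_rfl, hab⟩ b ⟨hab, le_rfl⟩
  have f1 := kobDist_triangle hM hconn hxM (hKM htK) ho
  have f2 := kobDist_triangle hM hconn hyM (hKM htK) ho
  rw [abs_of_nonneg (by linarith [ht.1, ht.2])] at e1 e2 e3
  rw [kobDist_comm (σ t)] at e1
  rw [kobDist_comm (σ b) (σ a)] at e3
  simp only [gromovProduct]
  linarith [hC _ htK]

end KobayashiVisibility

theorem mainTheorem8 {d : ℕ} (M S : Set (EuclideanSpace ℂ (Fin d)))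
    (hM : IsEmbeddedComplexSubmanifold M) (hconn : IsConnected M) (hbdd : Bornology.IsBounded M)
    (hSsub : S ⊆ bdry M) (hS : IsClosed S) (hsep : SphereSeparated M S)
    (o₀ : EuclideanSpace ℂ (Fin d)) (ho₀ : o₀ ∈ M)
    (hinf : ∀ p ∈ bdry M \ S, Filter.Tendsto (fun z => kobDist M z o₀) (nhdsWithin p M) Filter.atTop)
    (o : EuclideanSpace ℂ (Fin d)) (ho : o ∈ M) :
    List.TFAE [
      ∀ p ∈ bdry M \ S, ∀ q ∈ bdry M \ S, p ≠ q → GromovProductBoundedAt M o p q,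
      ∀ p ∈ bdry M, ∀ q ∈ bdry M, p ≠ q → GromovProductBoundedAt M o p q,
      (∀ kap : ℝ, 0 < kap → IsVisibilitySubmanifold M 1 kap) ∧ AlmostGeodesicsVisible M 1 0] ∧
    ((∀ kap : ℝ, 0 < kap → IsVisibilitySubmanifold M 1 kap) ∧ AlmostGeodesicsVisible M 1 0 →
      KobComplete M → IsBNTVisibilitySubmanifold M) := by
  have hSc : IsCompact S := hbdd.isCompact_closure.of_isClosed_subset hS
    (hSsub.trans Set.sdiff_subset)
  have hinf' : ∀ p ∈ bdry M \ S, Filter.Tendsto (fun z => kobDist M z o) (nhdsWithin p M)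
      Filter.atTop := by
    intro p hp
    refine Filter.tendsto_atTop_mono' _ ?_
      (Filter.tendsto_atTop_add_const_right _ (-kobDist M o o₀) (hinf p hp))
    filter_upwards [self_mem_nhdsWithin] with z hz
    linarith [kobDist_triangle hM hconn hz ho ho₀]
  have h21 : (∀ kap : ℝ, 0 < kap → IsVisibilitySubmanifold M 1 kap) →
      ∀ p ∈ bdry M, ∀ q ∈ bdry M, p ≠ q → GromovProductBoundedAt M o p q :=
    fun h p hp q hq hpq =>
      gromovProductBoundedAt_of_isVisibilitySubmanifold hM hconn (h 1 one_pos) ho hp hq hpq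
  constructor
  · tfae_have 1 → 2 := fun h p hp q hq hpq =>
      gromovProductBoundedAt_of_diff hM hconn hbdd hSc hsep ho h hp hq hpq
    tfae_have 2 → 1 := fun h p hp q hq hpq => h p hp.1 q hq.1 hpq
    tfae_have 3 → 2 := fun h => h21 h.1
    tfae_have 2 → 3 := by
      intro h
      have hvis : ∀ kap : ℝ, 0 ≤ kap → AlmostGeodesicsVisible M 1 kap := by
        intro kap hkap
        refine curvesVisible_of_gromovProductBoundedAt hM hconn hbdd hSc hsep ho hinf' h hkap
          fun a b σ hab hσ => ⟨?_, hσ.mapsTo, fun s hs t ht hst => ?_⟩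
        · simpa [Set.uIcc_of_le hab] using hσ.absolutelyContinuous.continuousOn
        · have e1 := hσ.lower s hs t ht
          have e2 := hσ.upper s hs t ht
          rw [abs_of_nonneg (by linarith), kobDist_comm] at e1 e2
          constructor <;> linarith
      exact ⟨fun kap hkap => ⟨joinedByAlmostGeodesics hM hconn hbdd hkap, hvis kap hkap.le⟩,
        hvis 0 le_rfl⟩
    tfae_finish
  · intro h hcomplete
    obtain ⟨C, hC⟩ := exists_dist_le_mul_kobDist hM hconn hbdd
    refine ⟨hcomplete, curvesVisible_of_gromovProductBoundedAt hM hconn hbdd hSc hsep ho hinf'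
      (h21 h.1) le_rfl fun a b σ hab hσ => ⟨?_, hσ.mapsTo, fun s hs t ht hst => ?_⟩⟩
    -- Real geodesics are not assumed continuous in the Euclidean topology; the comparison of
    -- distances makes them Lipschitz.
    · refine (LipschitzOnWith.of_dist_le_mul (K := C) fun s hs t ht => ?_).continuousOn
      rw [Real.dist_eq, hσ.isometry s hs t ht]
      exact hC _ (hσ.mapsTo hs) _ (hσ.mapsTo ht)
    · have e := hσ.isometry s hs t ht
      rw [abs_sub_comm, abs_of_nonneg (by linarith)] at e
      constructor <;> linarith
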